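/- **Setting.** For $g:\mathbb R^n\to\mathbb R$ let $Q(g;x)=\{q\in\mathbb R^n:\ \|q\|=1,\ \langle q,y-x\rangle\le 0\ \text{for all } y \text{ with } g(y)\le g(x)\}$ be its set of normalized subgradients at $x$; $g$ is quasi-convex if all its level sets $\{g\le\alpha\}$ are convex. Let $P$ be a probability distribution of $D$ and $f(x,D)$ a real function of $x\in\mathbb R^n$, measurable in $D$. Assume: $X\subseteq\mathbb R^n$ is convex and contained in the ball of radius $\bar B$ around $0$; $|f(x,D)|\le B$ for all $x\in X$ and all $D$; for every $D$ the function $f(\cdot,D)$ is $G$-Lipschitz ($G>0$) and quasi-convex on $\mathbb R^n$; and for all $M\ge 1$ and $D_1,\dots,D_M$ the average $\frac1M\sum_{i=1}^M f(\cdot,D_i)$ is quasi-convex on $\mathbb R^n$. Write $f(x)=\mathbb E_{D\sim P}[f(x,D)]$ and let $x^*\in\arg\min_{x\in X}f(x)$. **Method.** The projected stochastic normalized subgradient method starts at $x_1\in X$. At iteration $k$ it draws a fresh minibatch $D_{k,1},\dots,D_{k,b}$ of $b\ge1$ i.i.d. samples from $P$, independent of the past, puts $f_k(x)=\frac1b\sum_{i=1}^b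 f(x,D_{k,i})$, and sets $x_{k+1}=\mathrm{Proj}_X(x_k-\eta v_k)$ with some $v_k\in Q(f_k;x_k)$ (if $Q(f_k;x_k)=\emptyset$ and $x_k$ minimizes $f_k$ over $X$, then $v_k=0$ is allowed). The iterates $x_k$ are random variables depending only on what happened before the $k$-th minibatch is drawn. The output after $K\ge 1$ iterations is $\bar x_K=x_{\hat k}$, where $\hat k\in\arg\min_{1\le k\le K}f_k(x_k)$. **Theorem.** There is an absolute constant $C>0$ such that the following holds in every setting as above and for all $\varepsilon,\delta>0$. Suppose that the method is run (that is, almost surely all the steps exist) with $$\eta=\frac{\varepsilon}{2G},\qquad K\ge\frac{4G^2\|x_1-x^*\|^2}{\varepsilon^2},\qquad b\ge C\,\frac{nB^2\log\!\big(K\max\{1,G\bar B\}/\delta\big)}{2\varepsilon^2}.$$ Then, with probability at least $1-2\delta$, $\ f(\bar x_K)-f(x^*)\le 3\varepsilon$. -/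

import Mathlib

open MeasureTheory ProbabilityTheory
open scoped NNReal

/-- The level set `L(g; α) = {x | g x ≤ α}` of a function on `ℝⁿ`. -/
def levelSet {n : ℕ} (g : EuclideanSpace ℝ (Fin n) → ℝ) (α : ℝ) :
    Set (EuclideanSpace ℝ (Fin n)) :=
  {x | g x ≤ α}

/-- The normal cone `N(X, x) = {q | ⟪q, y - x⟫ ≤ 0 for all y ∈ X}`. -/
def normalCone {n : ℕ} (X : Set (EuclideanSpace ℝ (Fin n))) (x : EuclideanSpace ℝ (Fin n)) :
    Set (EuclideanSpace ℝ (Fin n)) :=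
  {q | ∀ y ∈ X, inner ℝ q (y - x) ≤ 0}

/-- The set of normalized subgradients `Q(g; x) = S(0,1) ∩ N(L(g; g x), x)`. -/
def normalizedSubgradients {n : ℕ} (g : EuclideanSpace ℝ (Fin n) → ℝ)
    (x : EuclideanSpace ℝ (Fin n)) : Set (EuclideanSpace ℝ (Fin n)) :=
  Metric.sphere 0 1 ∩ normalCone (levelSet g (g x)) x

/-- `p` is the Euclidean projection of `z` onto `X`: a point of `X` nearest to `z`
(unique when `X` is convex). -/
def IsProjOnto {n : ℕ} (X : Set (EuclideanSpace ℝ (Fin n)))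
    (z p : EuclideanSpace ℝ (Fin n)) : Prop :=
  p ∈ X ∧ ∀ y ∈ X, ‖z - p‖ ≤ ‖z - y‖

/-- The empirical average `x ↦ (1/M) ∑ i, f (x, D i)`. -/
noncomputable def empiricalAverage {n : ℕ} {𝒟 : Type*}
    (f : EuclideanSpace ℝ (Fin n) → 𝒟 → ℝ) {M : ℕ} (D : Fin M → 𝒟)
    (x : EuclideanSpace ℝ (Fin n)) : ℝ :=
  (1 / (M : ℝ)) * ∑ i, f x (D i)

/-- The expected objective `x ↦ 𝔼_{D ∼ P} [f (x, D)]`. -/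
noncomputable def expectedObjective {n : ℕ} {𝒟 : Type*} [MeasurableSpace 𝒟]
    (f : EuclideanSpace ℝ (Fin n) → 𝒟 → ℝ) (P : Measure 𝒟)
    (x : EuclideanSpace ℝ (Fin n)) : ℝ :=
  ∫ d, f x d ∂P

/-- The standing assumption on the feasible set `X` and the objective `f`. -/
structure QuasiconvexAssumption {n : ℕ} {𝒟 : Type*} (X : Set (EuclideanSpace ℝ (Fin n)))
    (f : EuclideanSpace ℝ (Fin n) → 𝒟 → ℝ) (Bbar B : ℝ) (G : ℝ≥0) : Prop where
  convex : Convex ℝ X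
  subset_ball : X ⊆ Metric.closedBall 0 Bbar
  bounded : ∀ x ∈ X, ∀ d, |f x d| ≤ B
  lipschitz : ∀ d, LipschitzWith G (fun x => f x d)
  quasiconvex : ∀ d, QuasiconvexOn ℝ Set.univ (fun x => f x d)
  quasiconvex_average : ∀ (M : ℕ), 0 < M → ∀ D : Fin M → 𝒟,
    QuasiconvexOn ℝ Set.univ (empiricalAverage f D)

/-- One update `x' = Proj_X (x - η v)` of the projected normalized subgradient method for the
function `g`, where `v ∈ Q(g; x)`.  If there is no normalized subgradient because `x` already
minimizes `g` over `X`, the method may take `v = 0`. -/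
def IsNormalizedSubgradientStep {n : ℕ} (X : Set (EuclideanSpace ℝ (Fin n)))
    (g : EuclideanSpace ℝ (Fin n) → ℝ) (η : ℝ) (x x' : EuclideanSpace ℝ (Fin n)) : Prop :=
  ∃ v : EuclideanSpace ℝ (Fin n),
    (v ∈ normalizedSubgradients g x ∨
      (normalizedSubgradients g x = ∅ ∧ IsMinOn g X x ∧ v = 0)) ∧
    IsProjOnto X (x - η • v) x'

/-- `K` iterations of the stochastic normalized subgradient method with step size `η` and
minibatches of size `b`, started at `x₁`.  Iterations are numbered from `0`, so `x k` is the
`(k+1)`-st iterate and `D k 0, …, D k (b-1)` is the minibatch sampled at it.  The σ-algebra `ℱ k`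
is the information available before the `k`-th minibatch is drawn (all previous minibatches and,
possibly, internal randomness used for choosing subgradients). -/
structure IsStochasticNormalizedSubgradientRun {n : ℕ} {𝒟 Ω : Type*} [MeasurableSpace 𝒟]
    [mΩ : MeasurableSpace Ω] (X : Set (EuclideanSpace ℝ (Fin n)))
    (f : EuclideanSpace ℝ (Fin n) → 𝒟 → ℝ) (P : Measure 𝒟) (μ : Measure Ω)
    (ℱ : Filtration ℕ mΩ) (η : ℝ) (b K : ℕ) (x₁ : EuclideanSpace ℝ (Fin n))
    (D : ℕ → Fin b → Ω → 𝒟) (x : ℕ → Ω → EuclideanSpace ℝ (Fin n)) : Prop where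
  /-- the minibatches are random variables, and become known once they are drawn -/
  sample_measurable : ∀ k < K, ∀ i, Measurable[ℱ (k + 1)] (D k i)
  /-- each sample has law `P` -/
  sample_law : ∀ k < K, ∀ i, μ.map (D k i) = P
  /-- the samples of one minibatch are independent -/
  sample_indep : ∀ k < K, iIndepFun (D k) μ
  /-- each minibatch is independent of the past -/
  sample_indep_past : ∀ k < K,
    Indep (MeasurableSpace.comap (fun ω i => D k i ω) MeasurableSpace.pi) (ℱ k) μ
  /-- each iterate is determined before the corresponding minibatch is drawn -/
  iterate_measurable : ∀ k < K, Measurable[ℱ k] (x k)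
  init : ∀ᵐ ω ∂μ, x 0 ω = x₁
  step : ∀ᵐ ω ∂μ, ∀ k < K,
    IsNormalizedSubgradientStep X (empiricalAverage f (fun i => D k i ω)) η (x k ω) (x (k + 1) ω)

/-- `p` is an output after `K` iterations: one of the iterates, at an index minimizing the
minibatch value `g k (x k)`. -/
def IsBestIterate {n : ℕ} (K : ℕ) (g : ℕ → EuclideanSpace ℝ (Fin n) → ℝ)
    (x : ℕ → EuclideanSpace ℝ (Fin n)) (p : EuclideanSpace ℝ (Fin n)) : Prop :=
  ∃ k < K, p = x k ∧ ∀ j < K, g k (x k) ≤ g j (x j)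

/-! Fresh minibatches replace uniform convergence. Deterministically, if `g k (x k) > g k z + ε` at
every step, the ball of radius `ε / G` around `z` lies in each sublevel set, so every step cuts the
squared distance to `z` by at least `3 * η ^ 2`; the bound on `K` forbids `K` such steps. Hence some
`j` has `g j (x j) ≤ g j z + ε` (`exists_le_add_of_isNormalizedSubgradientStep`). Taking `z =
xstar`, accuracy `3 * ε` follows if no minibatch underestimates the objective at its own iterate, or
overestimates it at `xstar`, by `ε`. The iterate is independent of its minibatch, so Hoeffding's
inequality at a fixed point bounds each of these `2 * K` events, and a union bound finishes
(`measureReal_output_le`). -/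

/-! ### Deterministic descent towards a better point -/

section Descent

variable {n : ℕ} {X : Set (EuclideanSpace ℝ (Fin n))}

/-- Projecting onto a convex set does not increase the distance to its points. -/
lemma IsProjOnto.norm_sub_sq_le {u p z : EuclideanSpace ℝ (Fin n)} (hX : Convex ℝ X)
    (h : IsProjOnto X u p) (hz : z ∈ X) : ‖p - z‖ ^ 2 ≤ ‖u - z‖ ^ 2 := by
  have hinf : ‖u - p‖ = ⨅ w : X, ‖u - w‖ := by
    have : Nonempty X := ⟨⟨p, h.1⟩⟩
    refine le_antisymm (le_ciInf fun w => h.2 w w.2) ?_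
    exact ciInf_le (f := fun w : X => ‖u - w‖) ⟨0, by rintro _ ⟨w, rfl⟩; positivity⟩ ⟨p, h.1⟩
  have hin := (norm_eq_iInf_iff_real_inner_le_zero hX h.1).1 hinf z hz
  have hexp : ‖u - z‖ ^ 2 = ‖u - p‖ ^ 2 - 2 * inner ℝ (u - p) (z - p) + ‖z - p‖ ^ 2 := by
    rw [← norm_sub_sq_real]; congr 2; abel
  rw [hexp, norm_sub_rev z p]
  nlinarith [sq_nonneg ‖u - p‖]

/-- One step of the method brings the iterate closer to any point `z` of `X` whose value is well
below that of the iterate. -/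
lemma IsNormalizedSubgradientStep.norm_sub_sq_le {g : EuclideanSpace ℝ (Fin n) → ℝ} {G : ℝ≥0}
    {η r : ℝ} {x x' z : EuclideanSpace ℝ (Fin n)} (hX : Convex ℝ X) (hg : LipschitzWith G g)
    (h : IsNormalizedSubgradientStep X g η x x') (hz : z ∈ X) (hη : 0 ≤ η) (hr : 0 ≤ r)
    (hgap : g z + G * r < g x) :
    ‖x' - z‖ ^ 2 ≤ ‖x - z‖ ^ 2 - 2 * η * r + η ^ 2 := by
  obtain ⟨v, hv, hp⟩ := h
  have hGr : 0 ≤ (G : ℝ) * r := by positivity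
  rcases hv with ⟨hv1, hvc⟩ | ⟨-, hmin, -⟩
  · have hv1 : ‖v‖ = 1 := by simpa using hv1
    -- Test the normal cone at `z + r • v`: the gap `G * r` keeps it in the level set, which gives
    -- `⟪v, x - z⟫ ≥ r`.
    have hval : g (z + r • v) ≤ g x := by
      have hd := hg.dist_le_mul (z + r • v) z
      rw [dist_eq_norm, dist_eq_norm, add_sub_cancel_left, norm_smul, hv1, mul_one,
        Real.norm_eq_abs, Real.norm_eq_abs, abs_of_nonneg hr] at hd
      linarith [le_abs_self (g (z + r • v) - g z)]
    have hin := hvc (z + r • v) hval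
    have hsplit : z + r • v - x = r • v - (x - z) := by abel
    rw [hsplit, inner_sub_right, real_inner_smul_right, real_inner_self_eq_norm_sq, hv1] at hin
    have hproj := hp.norm_sub_sq_le hX hz
    have hcomm : x - η • v - z = (x - z) - η • v := by abel
    rw [hcomm, norm_sub_sq_real (x - z), real_inner_smul_right, norm_smul, hv1, mul_one,
      Real.norm_eq_abs, sq_abs, real_inner_comm] at hproj
    nlinarith [mul_le_mul_of_nonneg_left (sub_nonneg.2 hin) hη]
  · have := hmin hz
    simp only [Set.mem_ofPred_eq] at this
    linarith

/-- Along `K` steps of the method, some iterate is nearly as good as `z` for its own function. -/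
lemma exists_le_add_of_isNormalizedSubgradientStep {g : ℕ → EuclideanSpace ℝ (Fin n) → ℝ}
    {G : ℝ≥0} {ε : ℝ} {K : ℕ} {x : ℕ → EuclideanSpace ℝ (Fin n)} {z : EuclideanSpace ℝ (Fin n)}
    (hX : Convex ℝ X) (hg : ∀ k, LipschitzWith G (g k)) (hG : 0 < G) (hε : 0 < ε) (hK : 0 < K)
    (hz : z ∈ X) (hKge : 4 * (G : ℝ) ^ 2 * ‖x 0 - z‖ ^ 2 / ε ^ 2 ≤ (K : ℝ))
    (hstep : ∀ k < K, IsNormalizedSubgradientStep X (g k) (ε / (2 * (G : ℝ))) (x k) (x (k + 1))) :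
    ∃ k < K, g k (x k) ≤ g k z + ε := by
  by_contra! hcon
  have hG' : (0 : ℝ) < G := hG
  set η : ℝ := ε / (2 * (G : ℝ)) with hηdef
  have hη : 0 < η := by positivity
  -- With `r = 2 * η` the one-step change is `-4 * η ^ 2 + η ^ 2 = -3 * η ^ 2`.
  have hε2 : ε = G * (2 * η) := by rw [hηdef]; field_simp
  have hdesc : ∀ k ≤ K, ‖x k - z‖ ^ 2 ≤ ‖x 0 - z‖ ^ 2 - 3 * η ^ 2 * k := by
    intro k
    induction k with
    | zero => intro _; simp
    | succ k ih =>
      intro hk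
      have h1 := (hstep k hk).norm_sub_sq_le hX (hg k) hz hη.le (r := 2 * η) (by positivity)
        (by rw [← hε2]; exact hcon k hk)
      have h2 := ih (by omega)
      push_cast
      nlinarith
  have hend := hdesc K le_rfl
  have hinit : ‖x 0 - z‖ ^ 2 ≤ η ^ 2 * K := by
    have : 4 * (G : ℝ) ^ 2 * ‖x 0 - z‖ ^ 2 / ε ^ 2 = ‖x 0 - z‖ ^ 2 / η ^ 2 := by
      rw [hηdef]; field_simp; ring
    rw [this, div_le_iff₀ (by positivity)] at hKge
    linarith
  have hKpos : (0 : ℝ) < K := by exact_mod_cast hK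
  nlinarith [sq_nonneg ‖x K - z‖, mul_pos (pow_pos hη 2) hKpos]

end Descent

/-! ### Regularity of averages and expectations -/

section Empirical

variable {n : ℕ} {𝒟 : Type*} {f : EuclideanSpace ℝ (Fin n) → 𝒟 → ℝ}

lemma lipschitzWith_empiricalAverage {G : ℝ≥0} {b : ℕ}
    (hf : ∀ d, LipschitzWith G (fun x => f x d)) (D : Fin b → 𝒟) :
    LipschitzWith G (empiricalAverage f D) := by
  refine LipschitzWith.of_dist_le_mul fun y z => ?_
  rcases Nat.eq_zero_or_pos b with rfl | hb
  · simp only [empiricalAverage, Finset.univ_eq_empty, Finset.sum_empty, mul_zero, dist_self]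
    positivity
  · have hb' : (0 : ℝ) < b := by exact_mod_cast hb
    rw [Real.dist_eq, empiricalAverage, empiricalAverage, ← mul_sub, ← Finset.sum_sub_distrib,
      abs_mul, abs_of_pos (by positivity), one_div, inv_mul_le_iff₀ hb']
    refine (Finset.abs_sum_le_sum_abs _ _).trans ?_
    refine (Finset.sum_le_card_nsmul _ _ (G * dist y z) fun i _ => ?_).trans (by simp)
    rw [← Real.dist_eq]
    exact (hf (D i)).dist_le_mul y z

variable [MeasurableSpace 𝒟]

lemma measurable_uncurry_of_lipschitzWith {G : ℝ≥0}
    (hf : ∀ d, LipschitzWith G (fun x => f x d)) (hm : ∀ y, Measurable (f y)) :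
    Measurable (Function.uncurry f) :=
  measurable_uncurry_of_continuous_of_measurable (fun d => (hf d).continuous) hm

lemma measurable_uncurry_empiricalAverage (hf : Measurable (Function.uncurry f)) {b : ℕ} :
    Measurable fun p : EuclideanSpace ℝ (Fin n) × (Fin b → 𝒟) => empiricalAverage f p.2 p.1 := by
  unfold empiricalAverage
  refine (Finset.measurable_sum _ fun i _ => ?_).const_mul _
  exact hf.comp (measurable_fst.prodMk ((measurable_pi_apply i).comp measurable_snd))

lemma measurable_expectedObjective {P : Measure 𝒟} [IsProbabilityMeasure P]
    (hf : Measurable (Function.uncurry f)) : Measurable (expectedObjective f P) :=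
  hf.stronglyMeasurable.integral_prod_right.measurable

end Empirical

/-! ### Hoeffding bounds and freezing an independent variable -/

section Concentration

variable {𝒟 : Type*} [MeasurableSpace 𝒟] {P : Measure 𝒟} [IsProbabilityMeasure P]

/-- Hoeffding's inequality for the mean of `b` independent samples. -/
lemma pi_real_le_mean_sub_integral {h : 𝒟 → ℝ} (hm : Measurable h) {B : ℝ}
    (hB : ∀ d, |h d| ≤ B) {b : ℕ} (hb : 0 < b) {ε : ℝ} (hε : 0 ≤ ε) :
    (Measure.pi fun _ : Fin b => P).real
      {D | ε ≤ (1 / (b : ℝ)) * ∑ i, h (D i) - ∫ d, h d ∂P}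
      ≤ Real.exp (-(b * ε ^ 2 / (2 * B ^ 2))) := by
  have hb' : (0 : ℝ) < b := by exact_mod_cast hb
  have hind : iIndepFun (fun (i : Fin b) (D : Fin b → 𝒟) => h (D i) - ∫ d, h d ∂P)
      (Measure.pi fun _ : Fin b => P) :=
    iIndepFun_pi (X := fun _ d => h d - ∫ d, h d ∂P) fun _ => (hm.sub_const _).aemeasurable
  have hsub : ∀ i ∈ (Finset.univ : Finset (Fin b)),
      HasSubgaussianMGF (fun D : Fin b → 𝒟 => h (D i) - ∫ d, h d ∂P)
        ((‖B - -B‖₊ / 2) ^ 2) (Measure.pi fun _ : Fin b => P) := by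
    intro i _
    -- Values in `[-B, B]` give variance proxy `B ^ 2`, whence the exponent `(b * ε) ^ 2 / (2 * b *
    -- B ^ 2)`.
    have hs := hasSubgaussianMGF_of_mem_Icc (μ := P) hm.aemeasurable
      (ae_of_all _ fun d => Set.mem_Icc.2 (abs_le.1 (hB d)))
    have hmp := measurePreserving_eval (fun _ : Fin b => P) i
    rw [← hmp.map_eq] at hs
    have := hs.of_map hmp.measurable.aemeasurable
    rw [hmp.map_eq] at this
    exact this
  have hmain := HasSubgaussianMGF.measure_sum_ge_le_of_iIndepFun hind hsub
    (ε := b * ε) (by positivity)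
  refine le_trans (le_of_eq ?_) (hmain.trans (le_of_eq ?_))
  · congr 1
    ext D
    simp only [Set.mem_ofPred_eq, Finset.sum_sub_distrib, Finset.sum_const, Finset.card_univ,
      Fintype.card_fin, nsmul_eq_mul]
    rw [← mul_le_mul_iff_right₀ hb']
    field_simp
  · congr 1
    simp only [sub_neg_eq_add, Finset.sum_const, Finset.card_univ, Fintype.card_fin,
      nsmul_eq_mul]
    push_cast
    rw [Real.norm_eq_abs, div_pow, sq_abs]
    rcases eq_or_ne B 0 with rfl | hB0
    · simp
    · field_simp
      ring

lemma pi_real_le_integral_sub_mean {h : 𝒟 → ℝ} (hm : Measurable h) {B : ℝ}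
    (hB : ∀ d, |h d| ≤ B) {b : ℕ} (hb : 0 < b) {ε : ℝ} (hε : 0 ≤ ε) :
    (Measure.pi fun _ : Fin b => P).real
      {D | ε ≤ ∫ d, h d ∂P - (1 / (b : ℝ)) * ∑ i, h (D i)}
      ≤ Real.exp (-(b * ε ^ 2 / (2 * B ^ 2))) := by
  have := pi_real_le_mean_sub_integral (P := P) hm.neg (B := B) (fun d => by simpa using hB d) hb hε
  refine le_trans (le_of_eq ?_) this
  congr 1
  ext D
  simp only [Set.mem_ofPred_eq, Pi.neg_apply, Finset.sum_neg_distrib, integral_neg]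
  rw [mul_neg, neg_sub_neg]

/-- A bound, uniform in `y`, on the probability of `(y, V) ∈ S` carries over to `(U, V) ∈ S` when
`U` is independent of `V`. -/
lemma IndepFun.measureReal_prodMk_mem_le {Ω α β : Type*} [MeasurableSpace Ω] [MeasurableSpace α]
    [MeasurableSpace β] {μ : Measure Ω} [IsProbabilityMeasure μ] {U : Ω → α} {V : Ω → β}
    (hUV : IndepFun U V μ) (hU : Measurable U) (hV : Measurable V) {S : Set (α × β)}
    (hS : MeasurableSet S) {c : ℝ} (hc : 0 ≤ c)
    (h : ∀ᵐ ω ∂μ, (μ.map V).real (Prod.mk (U ω) ⁻¹' S) ≤ c) :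
    μ.real {ω | (U ω, V ω) ∈ S} ≤ c := by
  have := Measure.isProbabilityMeasure_map (μ := μ) hU.aemeasurable
  have := Measure.isProbabilityMeasure_map (μ := μ) hV.aemeasurable
  have hset : μ {ω | (U ω, V ω) ∈ S} = ∫⁻ ω, (μ.map V) (Prod.mk (U ω) ⁻¹' S) ∂μ := by
    rw [← lintegral_map (f := fun y => (μ.map V) (Prod.mk y ⁻¹' S))
      (measurable_measure_prodMk_left hS) hU, ← Measure.prod_apply hS,
      ← (indepFun_iff_map_prod_eq_prod_map_map hU.aemeasurable hV.aemeasurable).1 hUV,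
      Measure.map_apply (hU.prodMk hV) hS]
    rfl
  refine ENNReal.toReal_le_of_le_ofReal hc ?_
  rw [hset]
  calc ∫⁻ ω, (μ.map V) (Prod.mk (U ω) ⁻¹' S) ∂μ ≤ ∫⁻ _, ENNReal.ofReal c ∂μ := by
        refine lintegral_mono_ae ?_
        filter_upwards [h] with ω hω
        exact (ENNReal.le_ofReal_iff_toReal_le (measure_ne_top _ _) hc).2 hω
    _ = ENNReal.ofReal c := by simp

end Concentration

/-! ### Probability of failure along a run -/

section Run

variable {n : ℕ} {𝒟 Ω : Type*} [MeasurableSpace 𝒟] [mΩ : MeasurableSpace Ω] {P : Measure 𝒟}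
  {μ : Measure Ω} {X : Set (EuclideanSpace ℝ (Fin n))} {f : EuclideanSpace ℝ (Fin n) → 𝒟 → ℝ}
  {Bbar B η : ℝ} {G : ℝ≥0} {K b : ℕ} {x₁ : EuclideanSpace ℝ (Fin n)}
  {ℱ : Filtration ℕ mΩ} {D : ℕ → Fin b → Ω → 𝒟} {x : ℕ → Ω → EuclideanSpace ℝ (Fin n)}

namespace IsStochasticNormalizedSubgradientRun

lemma measurable_minibatch
    (hR : IsStochasticNormalizedSubgradientRun X f P μ ℱ η b K x₁ D x) {k : ℕ} (hk : k < K) :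
    Measurable fun ω i => D k i ω :=
  measurable_pi_lambda _ fun i => (hR.sample_measurable k hk i).mono (ℱ.le _) le_rfl

lemma map_minibatch [IsProbabilityMeasure μ]
    (hR : IsStochasticNormalizedSubgradientRun X f P μ ℱ η b K x₁ D x) {k : ℕ} (hk : k < K) :
    μ.map (fun ω i => D k i ω) = Measure.pi fun _ => P := by
  have hm : ∀ i, Measurable (D k i) := fun i =>
    (hR.sample_measurable k hk i).mono (ℱ.le _) le_rfl
  rw [(iIndepFun_iff_map_fun_eq_pi_map fun i => (hm i).aemeasurable).1 (hR.sample_indep k hk)]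
  simp only [hR.sample_law k hk]

lemma indepFun_iterate_minibatch
    (hR : IsStochasticNormalizedSubgradientRun X f P μ ℱ η b K x₁ D x) {k : ℕ} (hk : k < K) :
    IndepFun (x k) (fun ω i => D k i ω) μ :=
  (indep_of_indep_of_le_right (hR.sample_indep_past k hk)
    (hR.iterate_measurable k hk).comap_le).symm

lemma ae_mem (hR : IsStochasticNormalizedSubgradientRun X f P μ ℱ η b K x₁ D x)
    (hx₁ : x₁ ∈ X) : ∀ᵐ ω ∂μ, ∀ k ≤ K, x k ω ∈ X := by
  filter_upwards [hR.init, hR.step] with ω h0 hs k hk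
  cases k with
  | zero => rwa [h0]
  | succ k =>
    obtain ⟨v, -, hp⟩ := hs k hk
    exact hp.1

variable [IsProbabilityMeasure P] [IsProbabilityMeasure μ]

/-- The minibatch value at an iterate is unlikely to underestimate the expected objective. -/
lemma measureReal_iterate_le (hR : IsStochasticNormalizedSubgradientRun X f P μ ℱ η b K x₁ D x)
    (hA : QuasiconvexAssumption X f Bbar B G) (hm : ∀ y, Measurable (f y)) (hx₁ : x₁ ∈ X)
    (hb : 0 < b) {ε : ℝ} (hε : 0 ≤ ε) {k : ℕ} (hk : k < K) :
    μ.real {ω | ε ≤ expectedObjective f P (x k ω)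
      - empiricalAverage f (fun i => D k i ω) (x k ω)}
      ≤ Real.exp (-(b * ε ^ 2 / (2 * B ^ 2))) := by
  have hf := measurable_uncurry_of_lipschitzWith hA.lipschitz hm
  refine IndepFun.measureReal_prodMk_mem_le (hR.indepFun_iterate_minibatch hk)
    ((hR.iterate_measurable k hk).mono (ℱ.le _) le_rfl) (hR.measurable_minibatch hk)
    (S := {p | ε ≤ expectedObjective f P p.1 - empiricalAverage f p.2 p.1})
    (measurableSet_le measurable_const
      (((measurable_expectedObjective hf).comp measurable_fst).sub
        (measurable_uncurry_empiricalAverage hf))) (Real.exp_pos _).le ?_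
  filter_upwards [hR.ae_mem hx₁] with ω hω
  rw [hR.map_minibatch hk]
  exact pi_real_le_integral_sub_mean (hm (x k ω))
    (hA.bounded _ (hω k hk.le)) hb hε

/-- The minibatch value at a fixed point is unlikely to overestimate the expected objective. -/
lemma measureReal_const_le (hR : IsStochasticNormalizedSubgradientRun X f P μ ℱ η b K x₁ D x)
    (hA : QuasiconvexAssumption X f Bbar B G) (hm : ∀ y, Measurable (f y))
    (hb : 0 < b) {ε : ℝ} (hε : 0 ≤ ε) {z : EuclideanSpace ℝ (Fin n)} (hz : z ∈ X)
    {k : ℕ} (hk : k < K) :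
    μ.real {ω | ε ≤ empiricalAverage f (fun i => D k i ω) z - expectedObjective f P z}
      ≤ Real.exp (-(b * ε ^ 2 / (2 * B ^ 2))) := by
  have h := pi_real_le_mean_sub_integral (P := P) (hm z) (hA.bounded z hz) hb hε
  rw [← hR.map_minibatch hk, map_measureReal_apply (hR.measurable_minibatch hk)] at h
  · exact h
  · refine measurableSet_le measurable_const (Measurable.sub_const ?_ _)
    exact (Finset.measurable_sum _ fun i _ => (hm z).comp (measurable_pi_apply i)).const_mul _

/-- The output misses accuracy `3 * ε` with probability at most that of `2 * K` deviations of
minibatch means. -/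
lemma measureReal_output_le {ε : ℝ} {xstar : EuclideanSpace ℝ (Fin n)}
    {xbar : Ω → EuclideanSpace ℝ (Fin n)}
    (hR : IsStochasticNormalizedSubgradientRun X f P μ ℱ (ε / (2 * (G : ℝ))) b K x₁ D x)
    (hA : QuasiconvexAssumption X f Bbar B G) (hm : ∀ y, Measurable (f y)) (hG : 0 < G)
    (hε : 0 < ε) (hK : 0 < K) (hb : 0 < b) (hxs : xstar ∈ X) (hx₁ : x₁ ∈ X)
    (hKge : 4 * (G : ℝ) ^ 2 * ‖x₁ - xstar‖ ^ 2 / ε ^ 2 ≤ (K : ℝ))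
    (hbest : ∀ᵐ ω ∂μ, IsBestIterate K (fun k => empiricalAverage f (fun i => D k i ω))
      (fun k => x k ω) (xbar ω)) :
    μ.real {ω | ¬ expectedObjective f P (xbar ω) - expectedObjective f P xstar ≤ 3 * ε}
      ≤ 2 * (K * Real.exp (-(b * ε ^ 2 / (2 * B ^ 2)))) := by
  set S : ℕ → Set Ω := fun k => {ω | ε ≤ expectedObjective f P (x k ω)
    - empiricalAverage f (fun i => D k i ω) (x k ω)} with hS
  set T : ℕ → Set Ω := fun k => {ω | ε ≤ empiricalAverage f (fun i => D k i ω) xstar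
    - expectedObjective f P xstar} with hT
  -- The failure set need not be measurable; covering it almost everywhere suffices. All `T k` are
  -- needed because the good index `j` depends on `ω`.
  have hsub : {ω | ¬ expectedObjective f P (xbar ω) - expectedObjective f P xstar ≤ 3 * ε}
      ≤ᵐ[μ] ⋃ k ∈ Finset.range K, (S k ∪ T k) := by
    filter_upwards [hR.init, hR.step, hbest] with ω h0 hs hbst hbad
    by_contra hnot
    have hgood : ∀ k < K, ω ∉ S k ∧ ω ∉ T k := by
      intro k hk
      constructor <;> intro hmem <;> refine hnot ?_ <;>
        refine Set.mem_iUnion₂.2 ⟨k, Finset.mem_range.2 hk, ?_⟩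
      exacts [Or.inl hmem, Or.inr hmem]
    obtain ⟨j, hj, hle⟩ := exists_le_add_of_isNormalizedSubgradientStep
      (g := fun k => empiricalAverage f (fun i => D k i ω)) (x := fun k => x k ω) hA.convex
      (fun k => lipschitzWith_empiricalAverage hA.lipschitz _) hG hε hK hxs (by rwa [h0]) hs
    obtain ⟨k, hk, hxk, hmin⟩ := hbst
    have h1 := (hgood k hk).1
    have h2 := (hgood j hj).2
    have h3 := hmin j hj
    simp only [hS, hT, Set.mem_ofPred_eq, not_le] at h1 h2
    refine hbad ?_
    rw [hxk]
    dsimp only at h3 hle ⊢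
    linarith
  calc _ ≤ μ.real (⋃ k ∈ Finset.range K, (S k ∪ T k)) :=
        ENNReal.toReal_mono (measure_ne_top _ _) (measure_mono_ae hsub)
    _ ≤ ∑ k ∈ Finset.range K, μ.real (S k ∪ T k) := measureReal_biUnion_finset_le _ _
    _ ≤ ∑ k ∈ Finset.range K, 2 * Real.exp (-(b * ε ^ 2 / (2 * B ^ 2))) := by
        refine Finset.sum_le_sum fun k hk => ?_
        have hk := Finset.mem_range.1 hk
        refine (measureReal_union_le _ _).trans ?_
        rw [two_mul]
        exact add_le_add (hR.measureReal_iterate_le hA hm hx₁ hb hε.le hk)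
          (hR.measureReal_const_le hA hm hb hε.le hxs hk)
    _ = _ := by rw [Finset.sum_const, Finset.card_range, nsmul_eq_mul]; ring

end IsStochasticNormalizedSubgradientRun

end Run

theorem mainTheorem2 :
    ∃ C : ℝ, 0 < C ∧
      ∀ (n : ℕ) (𝒟 : Type*) (Ω : Type*) [MeasurableSpace 𝒟] [mΩ : MeasurableSpace Ω]
        (P : Measure 𝒟) [IsProbabilityMeasure P] (μ : Measure Ω) [IsProbabilityMeasure μ]
        (X : Set (EuclideanSpace ℝ (Fin n))) (f : EuclideanSpace ℝ (Fin n) → 𝒟 → ℝ)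
        (Bbar B : ℝ) (G : ℝ≥0) (ε δ : ℝ) (K b : ℕ) (xstar x₁ : EuclideanSpace ℝ (Fin n))
        (ℱ : Filtration ℕ mΩ) (D : ℕ → Fin b → Ω → 𝒟)
        (x : ℕ → Ω → EuclideanSpace ℝ (Fin n)) (xbar : Ω → EuclideanSpace ℝ (Fin n)),
        QuasiconvexAssumption X f Bbar B G →
        (∀ y, Measurable (f y)) →
        0 < G → 0 < ε → 0 < δ → 0 < K → 0 < b →
        xstar ∈ X → IsMinOn (expectedObjective f P) X xstar →
        x₁ ∈ X →
        4 * (G : ℝ) ^ 2 * ‖x₁ - xstar‖ ^ 2 / ε ^ 2 ≤ (K : ℝ) →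
        C * ((n : ℝ) * B ^ 2 * Real.log ((K : ℝ) * max 1 ((G : ℝ) * Bbar) / δ) / (2 * ε ^ 2))
          ≤ (b : ℝ) →
        IsStochasticNormalizedSubgradientRun X f P μ ℱ (ε / (2 * (G : ℝ))) b K x₁ D x →
        (∀ᵐ ω ∂μ, IsBestIterate K (fun k => empiricalAverage f (fun i => D k i ω))
          (fun k => x k ω) (xbar ω)) →
        μ.real {ω | ¬ expectedObjective f P (xbar ω) - expectedObjective f P xstar ≤ 3 * ε}
          ≤ 2 * δ := by
  -- With `C = 4` the batch bound reads `n * log (…) ≤ b * ε ^ 2 / (2 * B ^ 2)`; union-bounding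
  -- needs only `log (K / δ)` on the left.
  refine ⟨4, by norm_num, ?_⟩
  intro n 𝒟 Ω _ mΩ P _ μ _ X f Bbar B G ε δ K b xstar x₁ ℱ D x xbar hA hm hG hε hδ hK hb hxs _ hx₁
    hKge hbge hR hbest
  rcases le_or_gt 1 (2 * δ) with hδ1 | hδ1
  · exact measureReal_le_one.trans hδ1
  -- For `n = 0` the batch bound is void, but the space is a single point.
  rcases Nat.eq_zero_or_pos n with rfl | hn
  · have hempty : {ω | ¬ expectedObjective f P (xbar ω) - expectedObjective f P xstar ≤ 3 * ε}
        = ∅ := by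
      ext ω
      have : xbar ω = xstar := Subsingleton.elim _ _
      simp [this, hε.le]
    rw [hempty, measureReal_empty]
    positivity
  -- For `B = 0` the exponent divides by zero and the tail bound degenerates to `1`, but `f`
  -- vanishes on `X`.
  rcases eq_or_ne B 0 with rfl | hB0
  · have hzero : ∀ y ∈ X, expectedObjective f P y = 0 := by
      intro y hy
      have : f y = 0 := funext fun d => abs_nonpos_iff.1 (hA.bounded y hy d)
      simp [expectedObjective, this]
    have hnull : {ω | ¬ expectedObjective f P (xbar ω) - expectedObjective f P xstar ≤ 3 * ε}
        =ᵐ[μ] (∅ : Set Ω) := by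
      rw [ae_eq_empty]
      refine ae_iff.1 ?_
      filter_upwards [hR.ae_mem hx₁, hbest] with ω hω hbst
      obtain ⟨k, hk, hxk, -⟩ := hbst
      rw [hxk, hzero _ (hω k hk.le), hzero _ hxs]
      linarith
    rw [measureReal_congr hnull, measureReal_empty]
    positivity
  have hKpos : (0 : ℝ) < K := by exact_mod_cast hK
  have hK1 : (1 : ℝ) ≤ K := by exact_mod_cast hK
  have hn1 : (1 : ℝ) ≤ n := by exact_mod_cast hn
  have hlog0 : 0 ≤ Real.log (K / δ) :=
    Real.log_nonneg ((one_le_div hδ).2 (by linarith))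
  have hlog : Real.log (K / δ) ≤ Real.log ((K : ℝ) * max 1 ((G : ℝ) * Bbar) / δ) := by
    refine Real.log_le_log (by positivity) ?_
    gcongr
    exact le_mul_of_one_le_right hKpos.le (le_max_left _ _)
  have hexp : Real.log (K / δ) ≤ b * ε ^ 2 / (2 * B ^ 2) := by
    have hnlog : Real.log (K / δ) ≤ n * Real.log ((K : ℝ) * max 1 ((G : ℝ) * Bbar) / δ) :=
      hlog.trans (le_mul_of_one_le_left (hlog0.trans hlog) hn1)
    rw [le_div_iff₀ (by positivity)]
    rw [show ∀ L : ℝ, 4 * ((n : ℝ) * B ^ 2 * L / (2 * ε ^ 2)) = 2 * B ^ 2 * (n * L) / ε ^ 2 from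
      fun L => by field_simp; ring, div_le_iff₀ (by positivity)] at hbge
    nlinarith [mul_le_mul_of_nonneg_left hnlog (sq_nonneg B)]
  refine (hR.measureReal_output_le hA hm hG hε hK hb hxs hx₁ hKge hbest).trans ?_
  have hfin : Real.exp (-(b * ε ^ 2 / (2 * B ^ 2))) ≤ δ / K := by
    rw [← Real.exp_log (show 0 < δ / (K : ℝ) by positivity), ← inv_div (K : ℝ) δ, Real.log_inv]
    exact Real.exp_le_exp.2 (neg_le_neg hexp)
  rw [le_div_iff₀ hKpos] at hfin
  linarith
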